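/- A symmetric $(v,k,\lambda)$ design over a set $V$ of $v$ points is a collection of $v$ distinct $k$-subsets of $V$ (blocks) such that every pair of distinct points lies in exactly $\lambda$ blocks. For an ordering $p_1,\ldots,p_v$ of the points and $B_1,\ldots,B_v$ of the blocks, its incidence matrix is the $\{0,1\}$-matrix with $(i,j)$ entry $1$ if $p_i\in B_j$ and $0$ otherwise. Let $\mathcal{C}^3(16,6,2)$ be the set of functions $C:\{1,\ldots,16\}^3\to\{0,1\}$ such that every $16\times 16$ matrix obtained from $C$ by fixing one of the three coordinates and varying the other two (in either order) is an incidence matrix of a symmetric $(16,6,2)$ design. Two such cubes are equivalent if one is obtained from the other by permuting the values $\{1,\ldots,16\}$ of each coordinate (by a separate permutation for each coordinate) and permuting the three coordinates. A $(16,6,2)$ difference set in a group $G$ of order $16$ is a $6$-subset $D\subseteq G$ such that every $g\in G\setminus\{1\}$ is equal to $d_1^{-1}d_2$ for exactly two pairs $(d_1,d_2)\in D\times D$. A group cube is a cube of the form $$C(i_1,i_2,i_3)=\begin{cases}1 & \text{if } g_{i_2}g_{i_3}\in B_{i_1},\\ 0 & \text{otherwise,}\end{cases}$$ where $G=\{g_1,\ldots,g_{16}\}$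 is a group of order $16$ and $\{B_1,\ldots,B_{16}\}$ is a symmetric $(16,6,2)$ design over $G$ all of whose blocks are $(16,6,2)$ difference sets in $G$. Proposition. The set $\mathcal{C}^3(16,6,2)$ contains at least $1423$ pairwise inequivalent cubes that are not equivalent to any group cube. -/

import Mathlib

/-! Cubes of symmetric designs. The set `{1, …, v}` is modelled by `Fin v`, the set of positions
`{1, …, n}` by `Fin n`, and the values `0`, `1` by `false`, `true`. -/

namespace SymCube

/-- `D` is (the set of blocks of) a symmetric `(v, k, l)` design over the point set `V`: there are
`v` points and `v` blocks, each block is a `k`-subset of `V`, and every pair of distinct points is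
contained in exactly `l` blocks. -/
structure IsSymmetricDesign {V : Type*} [Fintype V] [DecidableEq V] (v k l : ℕ)
    (D : Finset (Finset V)) : Prop where
  card_points : Fintype.card V = v
  card_blocks : D.card = v
  card_block : ∀ B ∈ D, B.card = k
  card_pair : ∀ p q : V, p ≠ q → (D.filter (fun B => p ∈ B ∧ q ∈ B)).card = l

/-- `A` is the incidence matrix of a symmetric `(v, k, l)` design, for some ordering
of its points and of its blocks: `A i j = [p i ∈ B j]`. (Without loss of generality the point set
is `Fin v`.) -/
def IsIncidenceMatrix (v k l : ℕ) (A : Matrix (Fin v) (Fin v) Bool) : Prop :=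
  ∃ D : Finset (Finset (Fin v)), IsSymmetricDesign v k l D ∧
    ∃ (p : Fin v ≃ Fin v) (B : Fin v ≃ {b : Finset (Fin v) // b ∈ D}),
      ∀ i j, A i j = decide (p i ∈ (B j : Finset (Fin v)))

/-- An `n`-cube of order `v`. -/
abbrev Cube (n v : ℕ) : Type := (Fin n → Fin v) → Bool

/-- The slice of `C` in which the positions `x` (rows) and `y` (columns) vary and the other
coordinates are fixed to the values given by `c` (the values `c x` and `c y` are irrelevant). -/
def slice {n v : ℕ} (C : Cube n v) (x y : Fin n) (c : Fin n → Fin v) :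
    Matrix (Fin v) (Fin v) Bool :=
  fun a b => C (Function.update (Function.update c x a) y b)

/-- The set `𝒞ⁿ(v, k, l)` of `n`-dimensional cubes of symmetric `(v, k, l)` designs. -/
def designCubes (n v k l : ℕ) : Set (Cube n v) :=
  {C | ∀ x y : Fin n, x ≠ y → ∀ c : Fin n → Fin v, IsIncidenceMatrix v k l (slice C x y c)}

/-- Action of `(S_v)ⁿ`: `C^α (i₁, …, iₙ) = C (α₁⁻¹ i₁, …, αₙ⁻¹ iₙ)`. -/
def isotope {n v : ℕ} (α : Fin n → Equiv.Perm (Fin v)) (C : Cube n v) : Cube n v :=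
  fun i => C (fun x => (α x)⁻¹ (i x))

/-- Action of `S_n`: `C^γ (i₁, …, iₙ) = C (i_{γ⁻¹ 1}, …, i_{γ⁻¹ n})`. -/
def conjugate {n v : ℕ} (γ : Equiv.Perm (Fin n)) (C : Cube n v) : Cube n v :=
  fun i => C (fun x => i (γ⁻¹ x))

/-- Equivalence (paratopy) of cubes: one is mapped to the other by a combination of an isotopy and
a conjugation. -/
def Equivalent {n v : ℕ} (C C' : Cube n v) : Prop :=
  ∃ (α : Fin n → Equiv.Perm (Fin v)) (γ : Equiv.Perm (Fin n)), C' = conjugate γ (isotope α C)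

/-- `D` is a `(v, k, l)` difference set in the group `G` of order `v`: a `k`-subset such that every
`g ≠ 1` is `d₁⁻¹ * d₂` for exactly `l` pairs `(d₁, d₂)` of elements of `D`. -/
structure IsDifferenceSet {G : Type*} [Group G] [Fintype G] [DecidableEq G] (v k l : ℕ)
    (D : Finset G) : Prop where
  card_group : Fintype.card G = v
  card_set : D.card = k
  card_diff : ∀ g : G, g ≠ 1 → ((D ×ˢ D).filter (fun d => d.1⁻¹ * d.2 = g)).card = l

/-- `C` is a group cube of dimension `m + 1`: for some group `G` with elements listed as
`g₁, …, g_v` and some symmetric `(v, k, l)` design over `G` with blocks listed as `B₁, …, B_v`, all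
of which are `(v, k, l)` difference sets in `G`, one has
`C (i₁, …, iₙ) = [g_{i₂} * ⋯ * g_{iₙ} ∈ B_{i₁}]`, where `n = m + 1`. -/
def IsGroupCube {m v : ℕ} (k l : ℕ) (C : Cube (m + 1) v) : Prop :=
  ∃ (G : Type) (_ : Group G) (_ : Fintype G) (_ : DecidableEq G)
    (g : Fin v ≃ G) (D : Finset (Finset G)) (B : Fin v ≃ {b : Finset G // b ∈ D}),
      IsSymmetricDesign v k l D ∧ (∀ b ∈ D, IsDifferenceSet v k l b) ∧
      ∀ i : Fin (m + 1) → Fin v,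
        C i = decide ((List.ofFn (fun j : Fin m => g (i j.succ))).prod ∈ (B (i 0) : Finset G))

/-- The set of non-group cubes in `𝒞ⁿ(v, k, l)`, `n = m + 1`: the cubes of symmetric `(v, k, l)`
designs that are not equivalent to any group cube. -/
def nonGroupCubes (m v k l : ℕ) : Set (Cube (m + 1) v) :=
  {C | C ∈ designCubes (m + 1) v k l ∧
    ∀ C' : Cube (m + 1) v, IsGroupCube k l C' → ¬ Equivalent C C'}

end SymCube

/-!
Let `B` be a nondegenerate pairing of two Klein four-groups `W` and `U` with values in `𝔽₂`.
For every `H : W³ → 𝔽₂` that vanishes on the triples of sum zero, the `16³` array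
`B (x₁ + x₂ + x₃) (y₁ + y₂ + y₃) + H (x₁, x₂, x₃)` has Maiorana–McFarland bent functions as its
lines. As parallel lines in a plane are orthogonal, the planes are regular Hadamard matrices, that
is, `(16, 6, 2)` designs. There are `2 ^ 48` such `H`.

The bilinear part cancels in the alternating sum of the array over the eight corners of a box.
Hence, for most `H`, these corner sums recognise which indices share their `W`-component, and
every equivalence between two such cubes comes from the few permutations that act on the
`W`-components by a common permutation followed by translations. This bounds the number of `H'`
whose cube is equivalent to that of `H` by `3! * 4! * 4² * 4¹² = 2304 * 2 ^ 24`.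

In a group cube every line in the direction of the blocks has a parallel copy through each index of
every other coordinate. For a twisted cube this forces the sums of `H` along the lines of one
direction to depend only on the sum of the other two coordinates, which again fails for most `H`.
Counting the exceptional `H` leaves at least `1789 * 2 ^ 36` of them, in more than `3180` classes.
-/

namespace SymCube

open Finset

theorem isIncidenceMatrix_of_counts {v k l : ℕ} (hlk : l < k) (A : Matrix (Fin v) (Fin v) Bool)
    (hcol : ∀ j, #{i | A i j = true} = k)
    (hrows : ∀ i i', i ≠ i' → #{j | A i j = true ∧ A i' j = true} = l)
    (hcols : ∀ j j', j ≠ j' → #{i | A i j = true ∧ A i j' = true} = l) :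
    IsIncidenceMatrix v k l A := by
  let b : Fin v → Finset (Fin v) := fun j => {i | A i j = true}
  have hb : Function.Injective b := by
    intro j j' h
    by_contra hne
    have hinter : ({i | A i j = true ∧ A i j' = true} : Finset (Fin v)) = b j := by
      rw [filter_and, show ({i | A i j' = true} : Finset (Fin v)) = b j from h.symm]
      exact inter_self _
    have hcard := hcols j j' hne
    rw [hinter, hcol j] at hcard
    exact hlk.ne' hcard
  refine ⟨univ.image b, ⟨Fintype.card_fin v, ?_, ?_, ?_⟩, Equiv.refl _,
    (Equiv.ofInjective b hb).trans (Equiv.subtypeEquivRight (by simp)), ?_⟩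
  · rw [card_image_of_injective _ hb, card_fin]
  · intro B hB
    obtain ⟨j, -, rfl⟩ := mem_image.1 hB
    exact hcol j
  · intro p q hpq
    rw [← hrows p q hpq, filter_image, card_image_of_injective _ hb]
    simp [b]
  · intro i j
    simp [b]

/-- The nontrivial character `x ↦ (-1)^x` of `ZMod 2`; it turns the condition that a `0`-`1` matrix
be an incidence matrix into orthogonality relations. -/
def signChar : AddChar (ZMod 2) ℤ :=
  AddChar.zmodChar 2 (by norm_num : (-1 : ℤ) ^ 2 = 1)

theorem two_mul_ite_eq_one (x : ZMod 2) :
    2 * (if x = 1 then 1 else 0) = 1 - signChar x := by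
  revert x; decide

theorem four_mul_ite_eq_one_and (x y : ZMod 2) :
    4 * (if x = 1 ∧ y = 1 then 1 else 0) =
      1 - signChar x - signChar y + signChar (x - y) := by
  revert x y; decide

theorem two_mul_card_eq_one {ι : Type*} [Fintype ι] (f : ι → ZMod 2) :
    2 * (#{i | f i = 1} : ℤ) = Fintype.card ι - ∑ i, signChar (f i) := by
  simp only [card_filter, Nat.cast_sum, mul_sum, Nat.cast_ite, Nat.cast_one, Nat.cast_zero,
    two_mul_ite_eq_one, sum_sub_distrib, sum_const, card_univ, nsmul_eq_mul, mul_one]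

theorem four_mul_card_eq_one_and {ι : Type*} [Fintype ι] (f g : ι → ZMod 2) :
    4 * (#{i | f i = 1 ∧ g i = 1} : ℤ) =
      Fintype.card ι - ∑ i, signChar (f i) - ∑ i, signChar (g i) +
        ∑ i, signChar (f i - g i) := by
  simp only [card_filter, Nat.cast_sum, mul_sum, Nat.cast_ite, Nat.cast_one, Nat.cast_zero,
    four_mul_ite_eq_one_and, sum_add_distrib, sum_sub_distrib, sum_const, card_univ,
    nsmul_eq_mul, mul_one]

/-- The hypotheses say that `(-1) ^ g i j` is a regular Hadamard matrix. -/
theorem isIncidenceMatrix_of_signChar_sums {v k l : ℕ} (hlk : l < k) (hv : v + 4 * l = 4 * k)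
    (g : Fin v → Fin v → ZMod 2)
    (hrow : ∀ i, ∑ j, signChar (g i j) = v - 2 * k)
    (hcol : ∀ j, ∑ i, signChar (g i j) = v - 2 * k)
    (hrows : ∀ i i', i ≠ i' → ∑ j, signChar (g i j - g i' j) = 0)
    (hcols : ∀ j j', j ≠ j' → ∑ i, signChar (g i j - g i j') = 0) :
    IsIncidenceMatrix v k l (fun i j => decide (g i j = 1)) := by
  refine isIncidenceMatrix_of_counts hlk _ (fun j => ?_) (fun i i' h => ?_) (fun j j' h => ?_) <;>
    simp only [decide_eq_true_eq]
  · have := two_mul_card_eq_one (fun i => g i j)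
    rw [hcol, Fintype.card_fin] at this
    omega
  · have := four_mul_card_eq_one_and (g i) (g i')
    rw [hrow, hrow, hrows i i' h, Fintype.card_fin] at this
    omega
  · have := four_mul_card_eq_one_and (fun i => g i j) (fun i => g i j')
    rw [hcol, hcol, hcols j j' h, Fintype.card_fin] at this
    omega

theorem sum_signChar_add_const_eq_zero {M : Type*} [AddCommGroup M] [Module (ZMod 2) M] [Fintype M]
    {f : M →ₗ[ZMod 2] ZMod 2} (hf : f ≠ 0) (c : ZMod 2) : ∑ y, signChar (f y + c) = 0 := by
  have hne : signChar.compAddMonoidHom f.toAddMonoidHom ≠ 0 := by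
    intro h
    have heq : ∀ z, signChar z = 1 → z = 0 := by decide
    exact hf (LinearMap.ext fun y => heq (f y) (DFunLike.congr_fun h y))
  have hsum := AddChar.sum_eq_zero_iff_ne_zero.2 hne
  simp only [AddChar.compAddMonoidHom_apply, LinearMap.toAddMonoidHom_coe] at hsum
  simp only [AddChar.map_add_eq_mul, ← sum_mul, hsum, zero_mul]

section Slices

variable {W U : Type*} [AddCommGroup W] [AddCommGroup U] [Module (ZMod 2) W] [Module (ZMod 2) U]
  {B : W →ₗ[ZMod 2] U →ₗ[ZMod 2] ZMod 2}

/-- The general two-dimensional slice of a twisted bilinear form, as a matrix over `ZMod 2`. -/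
def sliceForm (B : W →ₗ[ZMod 2] U →ₗ[ZMod 2] ZMod 2) (κ : W → W → ZMod 2) (o p q : W × U) :
    ZMod 2 :=
  B (p.1 + q.1 + o.1) (p.2 + q.2 + o.2) + κ p.1 q.1

theorem sum_signChar_sliceForm [Fintype W] [Fintype U] (hB : B.SeparatingLeft)
    {κ : W → W → ZMod 2} {o : W × U} (hκ : ∀ a b, a + b + o.1 = 0 → κ a b = 0) (p : W × U) :
    ∑ q, signChar (sliceForm B κ o p q) = Fintype.card U := by
  rw [Fintype.sum_prod_type, Finset.sum_eq_single (-p.1 - o.1)]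
  · have h0 : p.1 + (-p.1 - o.1) + o.1 = 0 := by abel
    simp only [sliceForm, h0, hκ _ _ h0, map_zero, LinearMap.zero_apply, add_zero,
      AddChar.map_zero_eq_one, sum_const, card_univ, nsmul_eq_mul, mul_one]
  · intro b _ hb
    have hne : B (p.1 + b + o.1) ≠ 0 := by
      intro h
      refine hb ?_
      have := hB _ (LinearMap.congr_fun h)
      rw [← sub_eq_zero, ← this]
      abel
    rw [← sum_signChar_add_const_eq_zero hne (B (p.1 + b + o.1) (p.2 + o.2) + κ p.1 b)]
    refine sum_congr rfl fun y _ => congrArg signChar ?_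
    simp only [sliceForm, map_add, LinearMap.add_apply]
    ring
  · exact fun h => absurd (mem_univ _) h

theorem sum_signChar_sliceForm_sub [Fintype W] [Fintype U] (hB : B.Nondegenerate)
    (κ : W → W → ZMod 2) (o : W × U) {p p' : W × U} (hp : p ≠ p') :
    ∑ q, signChar (sliceForm B κ o p q - sliceForm B κ o p' q) = 0 := by
  by_cases hfst : p.1 = p'.1
  · have hne : B.flip (p.2 - p'.2) ≠ 0 := fun h =>
      hp (Prod.ext hfst (sub_eq_zero.1 (hB.2 _ (LinearMap.congr_fun h))))
    rw [Fintype.sum_prod_type_right]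
    refine sum_eq_zero fun y _ => ?_
    rw [← sum_signChar_add_const_eq_zero hne (B (p'.1 + o.1) (p.2 - p'.2))]
    refine sum_congr rfl fun b _ => congrArg signChar ?_
    simp only [sliceForm, hfst, map_add, map_sub, LinearMap.add_apply, LinearMap.sub_apply,
      LinearMap.flip_apply]
    ring
  · have hne : B (p.1 - p'.1) ≠ 0 := fun h =>
      hfst (sub_eq_zero.1 (hB.1 _ (LinearMap.congr_fun h)))
    rw [Fintype.sum_prod_type]
    refine sum_eq_zero fun b _ => ?_
    rw [← sum_signChar_add_const_eq_zero hne (sliceForm B κ o p (b, 0) - sliceForm B κ o p' (b, 0))]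
    refine sum_congr rfl fun y _ => congrArg signChar ?_
    simp only [sliceForm, map_add, map_sub, map_zero, LinearMap.add_apply, LinearMap.sub_apply]
    ring

theorem isIncidenceMatrix_sliceForm [Finite W] [Fintype U] (hB : B.Nondegenerate)
    {κ : W → W → ZMod 2} {o : W × U} (hκ : ∀ a b, a + b + o.1 = 0 → κ a b = 0) {v k l : ℕ}
    (e : Fin v ≃ W × U) (hk : 2 * k + Fintype.card U = v) (hv : v + 4 * l = 4 * k) :
    IsIncidenceMatrix v k l (fun a b => decide (sliceForm B κ o (e a) (e b) = 1)) := by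
  cases nonempty_fintype W
  have hlk : l < k := by
    have : 0 < Fintype.card U := Fintype.card_pos
    omega
  have hU : (Fintype.card U : ℤ) = v - 2 * k := by omega
  have hswap : ∀ p q, sliceForm B κ o p q = sliceForm B (fun a b => κ b a) o q p := fun p q => by
    simp only [sliceForm, add_comm p.1, add_comm p.2]
  have hκ' : ∀ a b, a + b + o.1 = 0 → κ b a = 0 := fun a b h => hκ b a (add_comm b a ▸ h)
  refine isIncidenceMatrix_of_signChar_sums hlk hv (fun a b => sliceForm B κ o (e a) (e b))
    (fun i => ?_) (fun j => ?_) (fun i i' h => ?_) (fun j j' h => ?_)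
  · rw [← hU, ← sum_signChar_sliceForm hB.1 hκ (e i)]
    exact e.sum_comp fun q => signChar (sliceForm B κ o (e i) q)
  · rw [← hU, ← sum_signChar_sliceForm hB.1 hκ' (e j)]
    simp only [hswap _ (e j)]
    exact e.sum_comp fun q => signChar (sliceForm B (fun a b => κ b a) o (e j) q)
  · rw [← sum_signChar_sliceForm_sub hB κ o (e.injective.ne h)]
    exact e.sum_comp fun q => signChar (sliceForm B κ o (e i) q - sliceForm B κ o (e i') q)
  · rw [← sum_signChar_sliceForm_sub hB (fun a b => κ b a) o (e.injective.ne h)]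
    simp only [hswap _ (e j), hswap _ (e j')]
    exact e.sum_comp fun q =>
      signChar (sliceForm B (fun a b => κ b a) o (e j) q - sliceForm B _ o (e j') q)

end Slices

section TwistedForms

variable {ι W U : Type*} [Fintype ι] [AddCommGroup W] [AddCommGroup U] [Module (ZMod 2) W]
  [Module (ZMod 2) U] {B : W →ₗ[ZMod 2] U →ₗ[ZMod 2] ZMod 2}

/-- The form `((x₁, y₁), …, (xₙ, yₙ)) ↦ B (∑ xₜ) (∑ yₜ) + H (x₁, …, xₙ)`, the bilinear form of the
coordinate sums twisted by a function `H` of the first components. -/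
def twistedForm (B : W →ₗ[ZMod 2] U →ₗ[ZMod 2] ZMod 2) (H : (ι → W) → ZMod 2) (z : ι → W × U) :
    ZMod 2 :=
  B (∑ t, z t).1 (∑ t, z t).2 + H (Prod.fst ∘ z)

/-- The condition on `H` under which its twisted form has Hadamard slices. -/
def VanishesOnZeroSums (H : (ι → W) → ZMod 2) : Prop :=
  ∀ s, ∑ t, s t = 0 → H s = 0

/-- The cube of the twisted form of `H`, with the indices labelled by `W × U` through `e`. -/
def twistedCube {n v : ℕ} (e : Fin v ≃ W × U) (B : W →ₗ[ZMod 2] U →ₗ[ZMod 2] ZMod 2)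
    (H : (Fin n → W) → ZMod 2) : Cube n v :=
  fun i => decide (twistedForm B H (e ∘ i) = 1)

theorem twistedForm_update_update [DecidableEq ι] (H : (ι → W) → ZMod 2) (z : ι → W × U) {x y : ι}
    (hxy : x ≠ y) (p q : W × U) :
    twistedForm B H (Function.update (Function.update z x p) y q) =
      sliceForm B (fun a b => H (Function.update (Function.update (Prod.fst ∘ z) x a) y b))
        (∑ t ∈ (univ \ {y}) \ {x}, z t) p q := by
  have hsum : ∑ t, Function.update (Function.update z x p) y q t =
      p + q + ∑ t ∈ (univ \ {y}) \ {x}, z t := by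
    rw [sum_update_of_mem (mem_univ y), sum_update_of_mem (by simpa using hxy)]
    abel
  rw [twistedForm, sliceForm, hsum, Function.comp_update, Function.comp_update]
  rfl

theorem twistedCube_mem_designCubes [Finite W] [Fintype U] (hB : B.Nondegenerate) {n v k l : ℕ}
    (e : Fin v ≃ W × U) (hk : 2 * k + Fintype.card U = v) (hv : v + 4 * l = 4 * k)
    {H : (Fin n → W) → ZMod 2} (hH : VanishesOnZeroSums H) :
    twistedCube e B H ∈ designCubes n v k l := by
  intro x y hxy c
  have hslice := isIncidenceMatrix_sliceForm (o := ∑ t ∈ (univ \ {y}) \ {x}, (e ∘ c) t)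
    (κ := fun a b => H (Function.update (Function.update (Prod.fst ∘ e ∘ c) x a) y b))
    hB (fun a b hab => hH _ ?_) e hk hv
  · simp only [← twistedForm_update_update H _ hxy, ← Function.comp_update] at hslice
    exact hslice
  · rw [sum_update_of_mem (mem_univ y), sum_update_of_mem (by simpa using hxy), ← hab, Prod.fst_sum]
    simp only [Function.comp_apply]
    abel

end TwistedForms

section Equivalence

theorem equivalent_iff {n v : ℕ} {C C' : Cube n v} :
    Equivalent C C' ↔ ∃ (α : Fin n → Equiv.Perm (Fin v)) (γ : Equiv.Perm (Fin n)),
      ∀ i, C' i = C (fun x => α x (i (γ x))) :=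
  ⟨fun ⟨α, γ, h⟩ => ⟨fun x => (α x).symm, γ.symm, fun i => congrFun h i⟩,
    fun ⟨α, γ, h⟩ => ⟨fun x => (α x).symm, γ.symm, funext fun i => h i⟩⟩

theorem Equivalent.refl {n v : ℕ} (C : Cube n v) : Equivalent C C :=
  equivalent_iff.2 ⟨1, 1, fun _ => rfl⟩

theorem Equivalent.symm {n v : ℕ} {C C' : Cube n v} (h : Equivalent C C') : Equivalent C' C := by
  obtain ⟨α, γ, h⟩ := equivalent_iff.1 h
  refine equivalent_iff.2 ⟨fun x => (α (γ.symm x)).symm, γ.symm, fun i => ?_⟩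
  simp only [h, Equiv.symm_apply_apply, Equiv.apply_symm_apply]

/-- Every line in direction `d` has, through every value `j` of every other coordinate `p`, a
parallel line on which `f` takes the same values in the same order. Group cubes have
this property in direction `0`, and an equivalence carries it to some direction of the new cube. -/
def HasParallelLines {ι κ β : Type*} [DecidableEq ι] (f : (ι → κ) → β) (d : ι) : Prop :=
  ∀ c, ∀ p ≠ d, ∀ j, ∃ c', c' p = j ∧ ∀ i, f (Function.update c' d i) = f (Function.update c d i)

theorem Equivalent.exists_hasParallelLines {n v : ℕ} {C C' : Cube n v} (h : Equivalent C C')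
    {d : Fin n} (hC : HasParallelLines C d) : ∃ d', HasParallelLines C' d' := by
  obtain ⟨α, γ, h⟩ := equivalent_iff.1 h
  have hline : ∀ c j, C' (Function.update c (γ d) j) =
      C (Function.update (fun x => α x (c (γ x))) d (α d j)) := fun c j => by
    rw [h]
    congr 1
    funext x
    by_cases hx : x = d
    · subst hx; simp only [Function.update_self]
    · simp only [Function.update_of_ne hx, Function.update_of_ne (γ.injective.ne hx)]
  refine ⟨γ d, fun c p hp j => ?_⟩
  obtain ⟨c', hc', hlines⟩ := hC (fun x => α x (c (γ x))) (γ.symm p)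
    (fun h => hp (γ.symm_apply_eq.1 h)) (α (γ.symm p) j)
  refine ⟨fun x => (α (γ.symm x)).symm (c' (γ.symm x)), ?_, fun i => ?_⟩
  · simp only [hc', Equiv.symm_apply_apply]
  · simpa only [hline, Equiv.symm_apply_apply, Equiv.apply_symm_apply] using hlines (α d i)

theorem IsGroupCube.hasParallelLines {v k l : ℕ} {C : Cube 3 v} (h : IsGroupCube k l C) :
    HasParallelLines C 0 := by
  obtain ⟨G, _, _, _, g, D, Bl, -, -, hC⟩ := h
  have hline : ∀ c i, C (Function.update c 0 i) = decide (g (c 1) * g (c 2) ∈ (Bl i).1) :=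
    fun c i => by simp [hC]
  intro c p hp j
  suffices ∃ c' : Fin 3 → Fin v, c' p = j ∧ g (c' 1) * g (c' 2) = g (c 1) * g (c 2) by
    obtain ⟨c', hj, hprod⟩ := this
    exact ⟨c', hj, fun i => by rw [hline, hline, hprod]⟩
  fin_cases p
  · exact absurd rfl hp
  · exact ⟨![j, j, g.symm ((g j)⁻¹ * (g (c 1) * g (c 2)))], rfl, by simp⟩
  · exact ⟨![j, g.symm (g (c 1) * g (c 2) * (g j)⁻¹), j], rfl, by simp⟩

end Equivalence

section LineBalanced

variable {W U : Type*} [AddCommGroup W] [AddCommGroup U] [Module (ZMod 2) W] [Module (ZMod 2) U]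
  {B : W →ₗ[ZMod 2] U →ₗ[ZMod 2] ZMod 2}

theorem twistedForm_update {ι : Type*} [Fintype ι] [DecidableEq ι] (H : (ι → W) → ZMod 2)
    (z : ι → W × U) (d : ι) (q : W × U) :
    twistedForm B H (Function.update z d q) =
      B (q.1 + (∑ t ∈ univ \ {d}, z t).1) (q.2 + (∑ t ∈ univ \ {d}, z t).2) +
        H (Function.update (Prod.fst ∘ z) d q.1) := by
  rw [twistedForm, sum_update_of_mem (mem_univ d), Function.comp_update, Prod.fst_add,
    Prod.snd_add]

theorem decide_eq_one_inj {x y : ZMod 2} : decide (x = 1) = decide (y = 1) ↔ x = y := by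
  revert x y; decide

theorem hasParallelLines_twistedForm {n v : ℕ} {e : Fin v ≃ W × U} {H : (Fin n → W) → ZMod 2}
    {d : Fin n} (h : HasParallelLines (twistedCube e B H) d) :
    HasParallelLines (twistedForm B H) d := by
  intro z p hp q
  obtain ⟨c', hq, hlines⟩ := h (e.symm ∘ z) p hp (e.symm q)
  refine ⟨e ∘ c', by simp [hq], fun i => ?_⟩
  have := decide_eq_one_inj.1 (hlines (e.symm i))
  simpa [Function.comp_update, ← Function.comp_assoc] using this

/-- The sum of `H` along a line in direction `d` depends only on the sum of the other
coordinates. This is what remains of `HasParallelLines` for a twisted form when the bilinear part is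
summed away. -/
def IsLineBalanced {ι : Type*} [Fintype ι] [DecidableEq ι] [Fintype W] (H : (ι → W) → ZMod 2)
    (d : ι) : Prop :=
  ∀ s s' : ι → W, s d = s' d → ∑ t, s t = ∑ t, s' t →
    ∑ w, H (Function.update s d w) = ∑ w, H (Function.update s' d w)

theorem update_congr_of_sdiff_eq_pair {ι α : Type*} [Fintype ι] [DecidableEq ι] {d p r : ι}
    (h : univ \ {d} = {p, r}) {f g : ι → α} (hp : f p = g p) (hr : f r = g r) (a : α) :
    Function.update f d a = Function.update g d a := by
  refine Function.update_eq_iff.2 ⟨by rw [Function.update_self], fun x hx => ?_⟩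
  rw [Function.update_of_ne hx]
  have hx' : x ∈ ({p, r} : Finset ι) := h ▸ by simpa using hx
  rcases mem_insert.1 hx' with rfl | hx'
  · exact hp
  · rw [mem_singleton.1 hx', hr]

theorem HasParallelLines.isLineBalanced [Fintype W] (hB : B.SeparatingLeft)
    (hW : ∑ w : W, w = 0) {H : (Fin 3 → W) → ZMod 2} {d : Fin 3}
    (h : HasParallelLines (twistedForm B H) d) : IsLineBalanced H d := by
  intro s s' hd hs
  have hthird : ∀ d : Fin 3, ∃ p r, p ≠ d ∧ r ≠ p ∧ univ \ {d} = {p, r} := by decide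
  obtain ⟨p, r, hpd, hrp, hdiff⟩ := hthird d
  obtain ⟨z', hz', hlines⟩ := h (fun t => (s t, 0)) p hpd (s' p, 0)
  simp only [twistedForm_update, hdiff, sum_pair hrp.symm, hz', Prod.fst_add, Prod.snd_add,
    zero_add, add_zero] at hlines
  have hsum : s' p + (z' r).1 = s p + s r := by
    refine sub_eq_zero.1 (hB _ fun u => ?_)
    have hu := hlines (0, u)
    have h0 := hlines (0, 0)
    simp only [map_add, map_sub, LinearMap.add_apply, LinearMap.sub_apply, map_zero,
      zero_add] at hu h0 ⊢
    linear_combination hu - h0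
  have hr : (z' r).1 = s' r := by
    rw [sum_eq_sum_sdiff_singleton_add (mem_univ d), sum_eq_sum_sdiff_singleton_add (mem_univ d) s',
      hd, hdiff, sum_pair hrp.symm, sum_pair hrp.symm, add_left_inj, ← hsum] at hs
    exact add_left_cancel hs
  have hfst : ∀ w, Function.update (Prod.fst ∘ z') d w = Function.update s' d w :=
    update_congr_of_sdiff_eq_pair hdiff (congrArg Prod.fst hz') hr
  have hline : ∀ w, H (Function.update s d w) =
      B (w + (s p + s r)) (z' r).2 + H (Function.update s' d w) := fun w => by
    have := hlines (w, 0)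
    rw [hsum, hfst, zero_add, map_zero, zero_add] at this
    exact this.symm
  have htrans : ∑ w, (w + (s p + s r)) = 0 :=
    (Equiv.sum_comp (Equiv.addRight (s p + s r)) id).trans hW
  have hbilin : ∑ w, B (w + (s p + s r)) (z' r).2 = 0 := by
    rw [← LinearMap.sum_apply, ← map_sum, htrans, map_zero, LinearMap.zero_apply]
  simp only [hline, sum_add_distrib, hbilin, zero_add]

theorem twistedCube_mem_nonGroupCubes [Fintype W] [Fintype U] (hB : B.Nondegenerate)
    (hW : ∑ w : W, w = 0) {v k l : ℕ} (e : Fin v ≃ W × U) (hk : 2 * k + Fintype.card U = v)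
    (hv : v + 4 * l = 4 * k) {H : (Fin 3 → W) → ZMod 2} (hH : VanishesOnZeroSums H)
    (hline : ∀ d, ¬ IsLineBalanced H d) : twistedCube e B H ∈ nonGroupCubes 2 v k l := by
  refine ⟨twistedCube_mem_designCubes hB e hk hv hH, fun C' hC' h => ?_⟩
  obtain ⟨d, hd⟩ := h.symm.exists_hasParallelLines hC'.hasParallelLines
  exact hline d ((hasParallelLines_twistedForm hd).isLineBalanced hB.1 hW)

end LineBalanced

section CornerSums

variable {ι κ : Type*} [Fintype ι] [DecidableEq ι]

/-- The sum of `f` over the corners of the box spanned by `c` and `d`. On twisted forms of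
dimension at least three it does not see the bilinear part. -/
def cornerSum (f : (ι → κ) → ZMod 2) (c d : ι → κ) : ZMod 2 :=
  ∑ I : Finset ι, f (I.piecewise c d)

/-- The values `i`, `i'` of the coordinate `t` form a flat pair for `f` if the corner sums of all
boxes with these two values in direction `t` vanish. -/
def IsFlatPair (f : (ι → κ) → ZMod 2) (t : ι) (i i' : κ) : Prop :=
  ∀ c d, c t = i → d t = i' → cornerSum f c d = 0

/-- A function without flat pairs of distinct values. If `H` is rigid, then in dimension at least
three the flat pairs of its twisted form are exactly the pairs with equal first components. -/
def IsRigid (f : (ι → κ) → ZMod 2) : Prop :=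
  ∀ t i i', i ≠ i' → ¬ IsFlatPair f t i i'

theorem cornerSum_comp {κ' : Type*} (f : (ι → κ') → ZMod 2) (φ : ι → κ → κ') (c c' : ι → κ) :
    cornerSum (fun z => f fun t => φ t (z t)) c c' =
      cornerSum f (fun t => φ t (c t)) (fun t => φ t (c' t)) := by
  refine sum_congr rfl fun I _ => congrArg f (funext fun t => ?_)
  simp only [piecewise]
  split_ifs <;> rfl

theorem cornerSum_eq_zero_of_update {f : (ι → κ) → ZMod 2} {c c' : ι → κ} (t : ι)
    (h : ∀ d, f (Function.update d t (c t)) = f (Function.update d t (c' t))) :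
    cornerSum f c c' = 0 := by
  have hpair : ∀ I ∈ (univ.erase t).powerset,
      f (I.piecewise c c') + f ((insert t I).piecewise c c') = 0 := by
    intro I hI
    have ht : t ∉ I := fun ht => notMem_erase t univ (mem_powerset.1 hI ht)
    have hI' : I.piecewise c c' = Function.update (I.piecewise c c') t (c' t) := by
      rw [← piecewise_eq_of_notMem I c c' ht, Function.update_eq_self]
    rw [piecewise_insert, h, ← hI', CharTwo.add_self_eq_zero]
  rw [cornerSum, ← powerset_univ, ← insert_erase (mem_univ t), sum_powerset_insert
    (notMem_erase t univ), ← sum_add_distrib]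
  exact sum_eq_zero hpair

variable {W U : Type*} [AddCommGroup W] [AddCommGroup U] [Module (ZMod 2) W] [Module (ZMod 2) U]
  {B : W →ₗ[ZMod 2] U →ₗ[ZMod 2] ZMod 2}

theorem cornerSum_bilin_eq_zero (hι : 2 < Fintype.card ι) (z z' : ι → W × U) :
    cornerSum (fun z => B (∑ t, z t).1 (∑ t, z t).2) z z' = 0 := by
  have hterm : ∀ a b, cornerSum (fun z => B (z a).1 (z b).2) z z' = 0 := by
    intro a b
    obtain ⟨t, -, ht⟩ : ∃ t ∈ univ, t ∉ ({a, b} : Finset ι) :=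
      exists_mem_notMem_of_card_lt_card (card_le_two.trans_lt hι)
    simp only [mem_insert, mem_singleton, not_or] at ht
    refine cornerSum_eq_zero_of_update t fun d => ?_
    simp only [Function.update_of_ne (Ne.symm ht.1), Function.update_of_ne (Ne.symm ht.2)]
  simp only [cornerSum, Prod.fst_sum, Prod.snd_sum, map_sum, LinearMap.sum_apply] at hterm ⊢
  rw [sum_comm]
  refine sum_eq_zero fun a _ => ?_
  rw [sum_comm]
  exact sum_eq_zero fun b _ => hterm _ _

theorem cornerSum_twistedForm (hι : 2 < Fintype.card ι) (H : (ι → W) → ZMod 2) (z z' : ι → W × U) :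
    cornerSum (twistedForm B H) z z' = cornerSum H (Prod.fst ∘ z) (Prod.fst ∘ z') := by
  have hbilin := cornerSum_bilin_eq_zero (B := B) hι z z'
  have hH := cornerSum_comp H (fun _ => Prod.fst (α := W) (β := U)) z z'
  calc cornerSum (twistedForm B H) z z'
      = cornerSum (fun z => B (∑ t, z t).1 (∑ t, z t).2) z z' +
          cornerSum (fun z => H fun t => (z t).1) z z' := sum_add_distrib
    _ = cornerSum H (Prod.fst ∘ z) (Prod.fst ∘ z') := by rw [hbilin, hH, zero_add]; rfl

theorem isFlatPair_twistedForm_of_fst_eq (hι : 2 < Fintype.card ι) (H : (ι → W) → ZMod 2) (t : ι)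
    {p p' : W × U} (h : p.1 = p'.1) : IsFlatPair (twistedForm B H) t p p' := by
  intro c c' hc hc'
  rw [cornerSum_twistedForm hι]
  refine cornerSum_eq_zero_of_update t fun d => ?_
  simp only [Function.comp_apply, hc, hc', h]

theorem IsFlatPair.fst_eq (hι : 2 < Fintype.card ι) {H : (ι → W) → ZMod 2} (hH : IsRigid H) {t : ι}
    {p p' : W × U} (h : IsFlatPair (twistedForm B H) t p p') : p.1 = p'.1 := by
  by_contra hne
  refine hH t p.1 p'.1 hne fun c c' hc hc' => ?_
  have hlift : ∀ (c : ι → W) (p : W × U), c t = p.1 →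
      Prod.fst ∘ Function.update (fun x => (c x, (0 : U))) t p = c := fun c p hc => by
    rw [Function.comp_update, ← hc]
    exact Function.update_eq_self t c
  rw [← hlift c p hc, ← hlift c' p' hc', ← cornerSum_twistedForm (B := B) hι]
  exact h _ _ (Function.update_self ..) (Function.update_self ..)

theorem IsFlatPair.of_comp {κ' : Type*} {f : (ι → κ') → ZMod 2} {α : ι → κ ≃ κ'} {t : ι} {i i' : κ}
    (h : IsFlatPair (fun z => f fun t => α t (z t)) t i i') :
    IsFlatPair f t (α t i) (α t i') := by
  intro c c' hc hc'
  have := h (fun t => (α t).symm (c t)) (fun t => (α t).symm (c' t))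
    ((α t).symm_apply_eq.2 hc) ((α t).symm_apply_eq.2 hc')
  rw [cornerSum_comp f (fun t => α t)] at this
  simpa only [Equiv.apply_symm_apply] using this

end CornerSums

section ProductPermutations

variable {X Y : Type*}

theorem exists_perm_fst_eq [Finite X] [Nonempty Y] (α : Equiv.Perm (X × Y))
    (h : ∀ p p', p.1 = p'.1 → (α p).1 = (α p').1) : ∃ σ : Equiv.Perm X, ∀ p, (α p).1 = σ p.1 := by
  let y := Classical.arbitrary Y
  have hσ : ∀ p, (α p).1 = (α (p.1, y)).1 := fun p => h _ _ rfl
  have hsurj : Function.Surjective fun x => (α (x, y)).1 := fun x =>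
    ⟨(α.symm (x, y)).1, (hσ _).symm.trans (by rw [Equiv.apply_symm_apply])⟩
  exact ⟨Equiv.ofBijective _ (Finite.surjective_iff_bijective.1 hsurj), hσ⟩

theorem exists_snd_apply_eq {α : Equiv.Perm (X × Y)} {σ : Equiv.Perm X}
    (hσ : ∀ p, (α p).1 = σ p.1) (x : X) (y : Y) : ∃ y', (α (x, y')).2 = y := by
  have hx : (α.symm (σ x, y)).1 = x := by
    rw [← σ.injective.eq_iff, ← hσ, Equiv.apply_symm_apply]
  have heta : (x, (α.symm (σ x, y)).2) = α.symm (σ x, y) := Prod.ext hx.symm rfl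
  exact ⟨(α.symm (σ x, y)).2, by rw [heta, Equiv.apply_symm_apply]⟩

end ProductPermutations

section Isotopies

variable {W U : Type*} [AddCommGroup W] [AddCommGroup U] [Module (ZMod 2) W] [Module (ZMod 2) U]
  {B : W →ₗ[ZMod 2] U →ₗ[ZMod 2] ZMod 2}

theorem IsRigid.fst_apply_eq {ι : Type*} [Fintype ι] [DecidableEq ι] (hι : 2 < Fintype.card ι)
    {H H' : (ι → W) → ZMod 2} (hH : IsRigid H) {α : ι → Equiv.Perm (W × U)}
    (h : ∀ z, twistedForm B H' z = twistedForm B H fun t => α t (z t)) {t : ι} {p p' : W × U}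
    (hp : p.1 = p'.1) : (α t p).1 = (α t p').1 := by
  have hflat := isFlatPair_twistedForm_of_fst_eq (B := B) hι H' t hp
  rw [funext h] at hflat
  exact (IsFlatPair.of_comp hflat).fst_eq hι hH

theorem VanishesOnZeroSums.sum_perm_eq_zero {ι : Type*} [Fintype ι] [Nonempty ι]
    (hB : B.SeparatingLeft) {H H' : (ι → W) → ZMod 2} (hH' : VanishesOnZeroSums H')
    {α : ι → Equiv.Perm (W × U)} {σ : ι → Equiv.Perm W} (hσ : ∀ t p, (α t p).1 = σ t p.1)
    (h : ∀ z, twistedForm B H' z = twistedForm B H fun t => α t (z t))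
    {s : ι → W} (hs : ∑ t, s t = 0) : ∑ t, σ t (s t) = 0 := by
  classical
  obtain ⟨t₀⟩ := ‹Nonempty ι›
  have hform : ∀ u, B (∑ t, σ t (s t)) u + H (fun t => σ t (s t)) = 0 := fun u => by
    choose y hy using fun t => exists_snd_apply_eq (hσ t) (s t) (Pi.single (M := fun _ => U) t₀ u t)
    have hz := h fun t => (s t, y t)
    simp only [twistedForm, Prod.fst_sum, Prod.snd_sum, hs, hy, Function.comp_def, hσ, map_zero,
      LinearMap.zero_apply, hH' s hs, add_zero, sum_pi_single', mem_univ, if_true] at hz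
    exact hz.symm
  have hH : H (fun t => σ t (s t)) = 0 := by simpa only [map_zero, zero_add] using hform 0
  exact hB _ fun u => by simpa only [hH, add_zero] using hform u

theorem exists_eq_add_cons {m : ℕ} {σ : Fin (m + 1) → W → W}
    (hσ : ∀ s : Fin (m + 1) → W, ∑ t, s t = 0 → ∑ t, σ t (s t) = 0) :
    ∃ b : Fin m → W, ∀ t x, σ t x = σ 0 x + Fin.cons (α := fun _ => W) 0 b t := by
  refine ⟨fun j => σ 0 0 + σ j.succ 0, Fin.cases (fun x => (add_zero _).symm) fun j x => ?_⟩
  let s : Fin (m + 1) → W := fun r => if r = 0 ∨ r = j.succ then x else 0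
  have hne : (0 : Fin (m + 1)) ≠ j.succ := (Fin.succ_ne_zero j).symm
  have hs : ∑ r, s r = 0 := by
    rw [Fintype.sum_eq_add 0 j.succ hne fun r hr => if_neg (not_or.2 hr)]
    simp only [true_or, or_true, if_true, ZModModule.add_self]
  have hdiff : ∑ r, (σ r (s r) + σ r 0) = 0 := by
    rw [sum_add_distrib, hσ s hs, hσ (fun _ => 0) sum_const_zero, add_zero]
  rw [Fintype.sum_eq_add 0 j.succ hne fun r hr => by
    simp only [s, if_neg (not_or.2 hr), ZModModule.add_self]] at hdiff
  simp only [s, true_or, or_true, if_true] at hdiff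
  rw [← sub_eq_zero, ZModModule.sub_eq_add, Fin.cons_succ]
  exact Eq.trans (by abel) hdiff

/-- The restriction to `y = 0` of the twisted form of `H` after an isotopy and a permutation `γ` of
the coordinates. The isotopy acts on the first components by `σ` followed by the translations by
`0, b₀, …, bₘ₋₁`, and `τ` describes its effect on the second components. -/
def retwist (B : W →ₗ[ZMod 2] U →ₗ[ZMod 2] ZMod 2) {m : ℕ} (H : (Fin (m + 1) → W) → ZMod 2)
    (γ : Equiv.Perm (Fin (m + 1))) (σ : Equiv.Perm W) (b : Fin m → W) (τ : Fin (m + 1) → W → U) :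
    (Fin (m + 1) → W) → ZMod 2 :=
  fun s => twistedForm B H fun t =>
    (σ (s (γ t)) + Fin.cons (α := fun _ => W) 0 b t, τ t (s (γ t)))

theorem VanishesOnZeroSums.exists_eq_retwist_one [Finite W] (hB : B.SeparatingLeft) {m : ℕ}
    (hm : 2 ≤ m) {H H' : (Fin (m + 1) → W) → ZMod 2} (hH : IsRigid H) (hH' : VanishesOnZeroSums H')
    {α : Fin (m + 1) → Equiv.Perm (W × U)}
    (h : ∀ z, twistedForm B H' z = twistedForm B H fun t => α t (z t)) :
    ∃ σ b τ, H' = retwist B H 1 σ b τ := by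
  have hι : 2 < Fintype.card (Fin (m + 1)) := by rw [Fintype.card_fin]; omega
  choose σ hσ using fun t => exists_perm_fst_eq (α t) fun _ _ => hH.fst_apply_eq hι h
  obtain ⟨b, hb⟩ := exists_eq_add_cons (σ := fun t => σ t) fun s =>
    hH'.sum_perm_eq_zero hB hσ h
  refine ⟨σ 0, b, fun t w => (α t (w, 0)).2, funext fun s => ?_⟩
  have hα : ∀ t w, α t (w, 0) = (σ 0 w + Fin.cons (α := fun _ => W) 0 b t, (α t (w, 0)).2) :=
    fun t w => Prod.ext ((hσ t (w, 0)).trans (hb t w)) rfl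
  calc H' s = twistedForm B H' fun t => (s t, 0) := by
        simp only [twistedForm, Prod.snd_sum, sum_const_zero, map_zero, zero_add]; rfl
    _ = twistedForm B H fun t => α t (s t, 0) := h _
    _ = retwist B H 1 (σ 0) b (fun t w => (α t (w, 0)).2) s :=
        congrArg (twistedForm B H) (funext fun t => hα t (s t))

theorem exists_eq_retwist_of_equivalent [Finite W] (hB : B.SeparatingLeft) {m v : ℕ} (hm : 2 ≤ m)
    {e : Fin v ≃ W × U} {H H' : (Fin (m + 1) → W) → ZMod 2} (hH : IsRigid H)
    (hH' : VanishesOnZeroSums H') (h : Equivalent (twistedCube e B H) (twistedCube e B H')) :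
    ∃ γ σ b τ, H' = retwist B H γ σ b τ := by
  obtain ⟨α, γ, h⟩ := equivalent_iff.1 h
  have hform : ∀ z, twistedForm B (fun s => H' (s ∘ γ.symm)) z =
      twistedForm B H fun t => (e.symm.trans ((α t).trans e)) (z t) := by
    intro z
    have hz := decide_eq_one_inj.1 (h (e.symm ∘ z ∘ γ.symm))
    have hsum := Equiv.sum_comp γ.symm z
    simpa [twistedForm, hsum, Function.comp_def] using hz
  have hvanish : VanishesOnZeroSums fun s => H' (s ∘ γ.symm) := fun s hs =>
    hH' _ ((Equiv.sum_comp γ.symm s).trans hs)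
  obtain ⟨σ, b, τ, hτ⟩ := hvanish.exists_eq_retwist_one hB hm hH hform
  refine ⟨γ, σ, b, τ, funext fun s => ?_⟩
  have hs := congrFun hτ (s ∘ γ)
  rwa [Function.comp_assoc, Equiv.self_comp_symm, Function.comp_id] at hs

theorem ncard_equivalent_twistedCube_le [Fintype W] [Fintype U] (hB : B.SeparatingLeft) {m v : ℕ}
    (hm : 2 ≤ m) (e : Fin v ≃ W × U) {H : (Fin (m + 1) → W) → ZMod 2} (hH : IsRigid H) :
    {H' | VanishesOnZeroSums H' ∧ Equivalent (twistedCube e B H) (twistedCube e B H')}.ncard ≤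
      (m + 1).factorial * (Fintype.card W).factorial * Fintype.card W ^ m *
        (Fintype.card U ^ Fintype.card W) ^ (m + 1) := by
  classical
  let Φ (x : Equiv.Perm (Fin (m + 1)) × Equiv.Perm W × (Fin m → W) × (Fin (m + 1) → W → U)) :=
    retwist B H x.1 x.2.1 x.2.2.1 x.2.2.2
  have hsub : {H' | VanishesOnZeroSums H' ∧
      Equivalent (twistedCube e B H) (twistedCube e B H')} ⊆ Set.range Φ := by
    rintro H' ⟨hH', h⟩
    obtain ⟨γ, σ, b, τ, rfl⟩ := exists_eq_retwist_of_equivalent hB hm hH hH' h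
    exact ⟨(γ, σ, b, τ), rfl⟩
  calc _ ≤ (Set.range Φ).ncard := Set.ncard_le_ncard hsub
    _ ≤ (Set.univ : Set _).ncard := Set.image_univ (f := Φ) ▸ Set.ncard_image_le
    _ = _ := by
      simp only [Set.ncard_univ, Nat.card_eq_fintype_card, Fintype.card_prod, Fintype.card_perm,
        Fintype.card_fun, Fintype.card_fin, mul_assoc]

end Isotopies

section Counting

theorem ncard_le_card_pow_of_eqOn {α β : Type*} [Fintype β] {S : Set (α → β)} (T : Finset α)
    (h : ∀ f ∈ S, ∀ g ∈ S, Set.EqOn f g T → f = g) : S.ncard ≤ Fintype.card β ^ #T := by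
  have hinj : Set.InjOn T.restrict S := fun f hf g hg hfg =>
    h f hf g hg fun a ha => congrFun hfg ⟨a, ha⟩
  calc S.ncard ≤ (Set.univ : Set (T → β)).ncard :=
        Set.ncard_le_ncard_of_injOn _ (fun _ _ => Set.mem_univ _) hinj
    _ = Fintype.card β ^ #T := by
        rw [Set.ncard_univ, Nat.card_fun, Nat.card_eq_fintype_card, Nat.card_eq_fintype_card,
          Fintype.card_coe]

theorem eq_of_sum_eq_of_forall_ne {α M : Type*} [Fintype α] [AddCancelCommMonoid M]
    {f g : α → M} (h : ∑ x, f x = ∑ x, g x) (a : α) (hne : ∀ x ≠ a, f x = g x) : f a = g a := by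
  classical
  rw [← add_sum_erase univ f (mem_univ a), ← add_sum_erase univ g (mem_univ a),
    sum_congr rfl fun x hx => hne x (ne_of_mem_erase hx)] at h
  exact add_right_cancel h

theorem exists_pairwise_not_rel {α : Type*} {S : Set α} (hS : S.Finite) {r : α → α → Prop}
    (hrefl : ∀ a, r a a) (hsymm : ∀ a b, r a b → r b a) {N : ℕ}
    (hN : ∀ a ∈ S, {b ∈ S | r a b}.ncard ≤ N) :
    ∃ T ⊆ S, T.Pairwise (fun a b => ¬ r a b) ∧ S.ncard ≤ T.ncard * N := by
  obtain ⟨T, hT⟩ := (hS.finite_subsets.subset (Set.sep_subset _ fun T =>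
    T.Pairwise fun a b => ¬ r a b)).exists_maximal
      ⟨∅, Set.empty_subset S, Set.pairwise_empty _⟩
  have hcover : S ⊆ ⋃ a ∈ T, {b ∈ S | r a b} := by
    intro b hb
    by_contra hbT
    have hunrel : ∀ a ∈ T, ¬ r a b := fun a ha hr => hbT (Set.mem_biUnion ha ⟨hb, hr⟩)
    have hins : insert b T ⊆ T := hT.2 ⟨Set.insert_subset hb hT.prop.1, hT.prop.2.insert
      fun a ha _ => ⟨fun h => hunrel a ha (hsymm _ _ h), hunrel a ha⟩⟩ (Set.subset_insert b T)
    exact hunrel b (hins (Set.mem_insert b T)) (hrefl b)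
  have hTfin : T.Finite := hS.subset hT.prop.1
  refine ⟨T, hT.prop.1, hT.prop.2, ?_⟩
  have hunion : (⋃ a ∈ T, {b ∈ S | r a b}).Finite :=
    hS.subset (Set.iUnion₂_subset fun _ _ => Set.sep_subset _ _)
  calc S.ncard ≤ (⋃ a ∈ hTfin.toFinset, {b ∈ S | r a b}).ncard := by
        simpa only [Set.Finite.mem_toFinset] using Set.ncard_le_ncard hcover hunion
    _ ≤ ∑ a ∈ hTfin.toFinset, {b ∈ S | r a b}.ncard := set_ncard_biUnion_le _ _
    _ ≤ #hTfin.toFinset * N := sum_le_card_nsmul _ _ _ fun a ha =>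
        hN a (hT.prop.1 (hTfin.mem_toFinset.1 ha))
    _ = T.ncard * N := by rw [Set.ncard_eq_toFinset_card T hTfin]

end Counting

section TwistingFunctions

variable {ι W : Type*} [Fintype ι] [DecidableEq ι] [AddCommGroup W] [Fintype W] [DecidableEq W]

theorem two_pow_le_ncard_vanishesOnZeroSums :
    2 ^ #{s : ι → W | ∑ t, s t ≠ 0} ≤ {H : (ι → W) → ZMod 2 | VanishesOnZeroSums H}.ncard := by
  let S : Finset (ι → W) := {s | ∑ t, s t ≠ 0}
  let extend (f : S → ZMod 2) (s : ι → W) : ZMod 2 := if hs : s ∈ S then f ⟨s, hs⟩ else 0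
  have hinj : Set.InjOn extend Set.univ := fun f _ g _ hfg => funext fun s => by
    simpa only [extend, s.2, dif_pos] using congrFun hfg s
  have hmaps : ∀ f ∈ Set.univ, VanishesOnZeroSums (extend f) := fun f _ s hs =>
    dif_neg fun h : s ∈ S => (mem_filter.1 h).2 hs
  calc 2 ^ #S = (Set.univ : Set (S → ZMod 2)).ncard := by
        rw [Set.ncard_univ, Nat.card_fun, Nat.card_zmod, Nat.card_eq_fintype_card,
          Fintype.card_coe]
    _ ≤ {H : (ι → W) → ZMod 2 | VanishesOnZeroSums H}.ncard :=
        Set.ncard_le_ncard_of_injOn extend hmaps hinj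

theorem ncard_isFlatPair_le (t : ι) {u u' : W} (hu : u ≠ u') :
    {H : (ι → W) → ZMod 2 | VanishesOnZeroSums H ∧ IsFlatPair H t u u'}.ncard ≤
      2 ^ #{s : ι → W | ∑ r, s r ≠ 0 ∧ ¬ (s t = u ∧ ∀ r ≠ t, s r ≠ 0)} := by
  refine ncard_le_card_pow_of_eqOn _ fun f hf g hg hfg => ?_
  have hagree : ∀ s : ι → W, ¬ (s t = u ∧ ∀ r ≠ t, s r ≠ 0) → f s = g s := by
    intro s hs
    by_cases h0 : ∑ r, s r = 0
    · rw [hf.1 s h0, hg.1 s h0]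
    · exact hfg (mem_coe.2 (mem_filter.2 ⟨mem_univ s, h0, hs⟩))
  funext s
  by_cases hs : s t = u ∧ ∀ r ≠ t, s r ≠ 0
  swap
  · exact hagree s hs
  let c' : ι → W := Function.update 0 t u'
  have hc' : ∀ r, c' r ≠ s r := fun r => by
    by_cases hr : r = t
    · rw [hr, hs.1]; exact (Function.update_self ..).trans_ne hu.symm
    · exact (Function.update_of_ne hr ..).trans_ne (hs.2 r hr).symm
  have hcorner : cornerSum f s c' = cornerSum g s c' := by
    rw [hf.2 s c' hs.1 (Function.update_self ..), hg.2 s c' hs.1 (Function.update_self ..)]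
  have hne : ∀ I : Finset ι, I ≠ univ → f (I.piecewise s c') = g (I.piecewise s c') := by
    intro I hI
    obtain ⟨r, hr⟩ : ∃ r, r ∉ I := by simpa [eq_univ_iff_forall] using hI
    have hval : I.piecewise s c' r = c' r := piecewise_eq_of_notMem I s c' hr
    refine hagree _ fun ⟨ht, hr0⟩ => ?_
    by_cases hrt : r = t
    · rw [← hrt, hval] at ht
      exact hc' r (by rw [ht, hrt, hs.1])
    · exact hr0 r hrt (hval.trans (Function.update_of_ne hrt ..))
  simpa only [piecewise_univ] using eq_of_sum_eq_of_forall_ne hcorner univ hne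

theorem ncard_isLineBalanced_le {p r d : ι} (hpr : p ≠ r) (hpd : p ≠ d) (hrd : r ≠ d) (a : W) :
    {H : (ι → W) → ZMod 2 | VanishesOnZeroSums H ∧ IsLineBalanced H d}.ncard ≤
      2 ^ #{s : ι → W | ∑ t, s t ≠ 0 ∧ ¬ (∑ t, s t = a ∧ s p ≠ 0)} := by
  refine ncard_le_card_pow_of_eqOn _ fun f hf g hg hfg => ?_
  have hagree : ∀ s : ι → W, ¬ (∑ t, s t = a ∧ s p ≠ 0) → f s = g s := by
    intro s hs
    by_cases h0 : ∑ t, s t = 0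
    · rw [hf.1 s h0, hg.1 s h0]
    · exact hfg (mem_coe.2 (mem_filter.2 ⟨mem_univ s, h0, hs⟩))
  funext s
  by_cases hs : ∑ t, s t = a ∧ s p ≠ 0
  swap
  · exact hagree s hs
  let s' := s - Pi.single p (s p) + Pi.single r (s p)
  have hp' : s' p = 0 := by simp [s', hpr]
  have hd' : s d = s' d := by simp [s', hpd.symm, hrd.symm]
  have hsum : ∑ t, s t = ∑ t, s' t := by simp [s', sum_add_distrib, sum_sub_distrib]
  have hlines : ∑ w, f (Function.update s d w) = ∑ w, g (Function.update s d w) := by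
    rw [hf.2 s s' hd' hsum, hg.2 s s' hd' hsum]
    refine sum_congr rfl fun w _ => hagree _ fun h => h.2 ?_
    rw [Function.update_of_ne hpd, hp']
  have hne : ∀ w ≠ s d, f (Function.update s d w) = g (Function.update s d w) := by
    intro w hw
    refine hagree _ fun h => hw ?_
    have heq := h.1.trans hs.1.symm
    rw [sum_update_of_mem (mem_univ d), sum_eq_sum_sdiff_singleton_add (mem_univ d) s,
      add_comm] at heq
    exact add_left_cancel heq
  simpa only [Function.update_eq_self] using eq_of_sum_eq_of_forall_ne hlines (s d) hne

end TwistingFunctions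

section KleinFourGroup

/-- The twisting functions avoiding every condition that could make their cubes group cubes
(line balance) or enlarge the set of equivalences between these cubes (flat pairs). -/
def genericTwists (W : Type*) [AddCommGroup W] [Fintype W] : Set ((Fin 3 → W) → ZMod 2) :=
  {H | VanishesOnZeroSums H ∧ IsRigid H ∧ ∀ d, ¬ IsLineBalanced H d}

/-- The Klein four-group, as the plane over `ZMod 2`. -/
abbrev KleinFour : Type := Fin 2 → ZMod 2

theorem ncard_isFlatPair_kleinFour_le (t : Fin 3) {u u' : KleinFour} (hu : u ≠ u') :
    {H : (Fin 3 → KleinFour) → ZMod 2 | VanishesOnZeroSums H ∧ IsFlatPair H t u u'}.ncard ≤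
      2 ^ 42 := by
  refine (ncard_isFlatPair_le t hu).trans (Nat.pow_le_pow_right two_pos ?_)
  clear hu
  revert t u
  decide +kernel

theorem ncard_isLineBalanced_kleinFour_le (d : Fin 3) :
    {H : (Fin 3 → KleinFour) → ZMod 2 | VanishesOnZeroSums H ∧ IsLineBalanced H d}.ncard ≤
      2 ^ 36 := by
  have hthird : ∀ d : Fin 3, ∃ p r, p ≠ r ∧ p ≠ d ∧ r ≠ d := by decide
  obtain ⟨p, r, hpr, hpd, hrd⟩ := hthird d
  refine (ncard_isLineBalanced_le hpr hpd hrd (Pi.single 0 1)).trans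
    (Nat.pow_le_pow_right two_pos ?_)
  clear hpr hpd
  revert p
  decide +kernel

theorem le_ncard_genericTwists : 1789 * 2 ^ 36 ≤ (genericTwists KleinFour).ncard := by
  let pairs : Finset (Fin 3 × KleinFour × KleinFour) := {x | x.2.1 ≠ x.2.2}
  let flat (x : Fin 3 × KleinFour × KleinFour) : Set ((Fin 3 → KleinFour) → ZMod 2) :=
    {H | VanishesOnZeroSums H ∧ IsFlatPair H x.1 x.2.1 x.2.2}
  let balanced (d : Fin 3) : Set ((Fin 3 → KleinFour) → ZMod 2) :=
    {H | VanishesOnZeroSums H ∧ IsLineBalanced H d}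
  have hpairs : #pairs = 36 := by decide +kernel
  have hflat : ∑ x ∈ pairs, (flat x).ncard ≤ 36 * 2 ^ 42 :=
    (sum_le_card_nsmul _ _ _ fun x hx =>
      ncard_isFlatPair_kleinFour_le x.1 (mem_filter.1 hx).2).trans_eq (by rw [hpairs, smul_eq_mul])
  have hbalanced : ∑ d, (balanced d).ncard ≤ 3 * 2 ^ 36 :=
    sum_le_card_nsmul _ _ _ fun d _ => ncard_isLineBalanced_kleinFour_le d
  have hcover : {H : (Fin 3 → KleinFour) → ZMod 2 | VanishesOnZeroSums H} ⊆
      genericTwists KleinFour ∪ (⋃ x ∈ pairs, flat x) ∪ ⋃ d ∈ univ, balanced d := by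
    intro H hH
    by_contra h
    simp only [Set.mem_union, Set.mem_iUnion, not_or, not_exists] at h
    exact h.1.1 ⟨hH, fun t i i' hi hf => h.1.2 (t, i, i') (mem_filter.2 ⟨mem_univ _, hi⟩) ⟨hH, hf⟩,
      fun d hd => h.2 d (mem_univ d) ⟨hH, hd⟩⟩
  have htotal := calc
    2 ^ 48 ≤ {H : (Fin 3 → KleinFour) → ZMod 2 | VanishesOnZeroSums H}.ncard :=
      (Nat.pow_le_pow_right two_pos (by decide +kernel)).trans two_pow_le_ncard_vanishesOnZeroSums
    _ ≤ (genericTwists KleinFour ∪ (⋃ x ∈ pairs, flat x) ∪ ⋃ d ∈ univ, balanced d).ncard :=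
      Set.ncard_le_ncard hcover
    _ ≤ (genericTwists KleinFour).ncard + ∑ x ∈ pairs, (flat x).ncard + ∑ d, (balanced d).ncard :=
      (Set.ncard_union_le _ _).trans <| add_le_add ((Set.ncard_union_le _ _).trans <|
        add_le_add_right (set_ncard_biUnion_le _ _) _) (set_ncard_biUnion_le _ _)
  omega

theorem nondegenerate_dotProductBilin {ι K : Type*} [Fintype ι] [CommSemiring K] :
    (dotProductBilin K K : (ι → K) →ₗ[K] (ι → K) →ₗ[K] K).Nondegenerate :=
  ⟨fun _ => dotProduct_eq_zero _, fun v h => dotProduct_eq_zero v fun w =>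
    dotProduct_comm v w ▸ h w⟩

end KleinFourGroup

end SymCube

open SymCube in
theorem proposition5p2_general : ∃ C : Fin 3181 → Cube 3 16,
    (∀ a, C a ∈ nonGroupCubes 2 16 6 2) ∧ ∀ a b, a ≠ b → ¬ Equivalent (C a) (C b) := by
  let B : KleinFour →ₗ[ZMod 2] KleinFour →ₗ[ZMod 2] ZMod 2 := dotProductBilin (ZMod 2) (ZMod 2)
  have hB : B.Nondegenerate := nondegenerate_dotProductBilin
  have hcard : Fintype.card KleinFour = 4 := by decide
  let e : Fin 16 ≃ KleinFour × KleinFour := Fintype.equivOfCardEq (by decide)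
  have hclass : ∀ H ∈ genericTwists KleinFour, {H' ∈ genericTwists KleinFour |
      Equivalent (twistedCube e B H) (twistedCube e B H')}.ncard ≤ 2304 * 2 ^ 24 := fun H hH =>
    (Set.ncard_le_ncard (Set.ofPred_subset_ofPred.2 fun _ h => ⟨h.1.1, h.2⟩)).trans <|
      (ncard_equivalent_twistedCube_le hB.1 le_rfl e hH.2.1).trans_eq (by rw [hcard]; decide)
  obtain ⟨T, hT, hpair, hcount⟩ := exists_pairwise_not_rel (genericTwists KleinFour).toFinite
    (fun _ => .refl _) (fun _ _ => .symm) hclass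
  have hlarge : 3181 ≤ Nat.card T := by
    have := le_ncard_genericTwists.trans hcount
    rw [← Nat.card_coe_set_eq] at this
    omega
  let H (a : Fin 3181) : T := (Finite.equivFin T).symm (Fin.castLE hlarge a)
  have hH : Function.Injective H :=
    (Finite.equivFin T).symm.injective.comp (Fin.castLE_injective hlarge)
  refine ⟨fun a => twistedCube e B (H a).1, fun a => ?_, fun a b hab =>
    hpair (H a).2 (H b).2 (Subtype.coe_injective.ne (hH.ne hab))⟩
  exact twistedCube_mem_nonGroupCubes hB (by decide) e (by rw [hcard]) rfl (hT (H a).2).1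
    (hT (H a).2).2.2

/-- There are at least `1423` pairwise inequivalent non-group cubes in `𝒞³(16, 6, 2)`. -/
theorem proposition5p2 :
    ∃ C : Fin 1423 → SymCube.Cube 3 16,
      (∀ a, C a ∈ SymCube.nonGroupCubes 2 16 6 2) ∧
      ∀ a b, a ≠ b → ¬ SymCube.Equivalent (C a) (C b) := by
  obtain ⟨C, hC, hne⟩ := proposition5p2_general
  have hle : 1423 ≤ 3181 := by norm_num
  exact ⟨fun a => C (Fin.castLE hle a), fun a => hC _, fun a b hab =>
    hne _ _ ((Fin.castLE_injective hle).ne hab)⟩
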